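/- Regard the square lattice $\mathbb{Z}^2$ as the graph in which $u,v\in\mathbb{Z}^2$ are adjacent iff $u-v\in\{\pm(1,0),\pm(0,1)\}$, with edge set $E(\mathbb{Z}^2)$. An edge percolation measure on $\mathbb{Z}^2$ is a probability measure $\mu$ on $\{0,1\}^{E(\mathbb{Z}^2)}$ with the product $\sigma$-algebra; it is translation-invariant if it is invariant under the natural action of $\mathbb{Z}^2$ by translations. An edge $e$ is open in a configuration $\omega$ if $\omega_e=1$ and closed if $\omega_e=0$; the clusters of $\omega$ are the connected components of the graph formed by all vertices and the open edges. The dual $\omega^*$ of $\omega$ is a configuration on the planar dual lattice, whose vertices are the plaquettes (unit-square faces) of $\mathbb{Z}^2$, two plaquettes being adjacent iff they share a side: the dual edge joining two adjacent plaquettes is open in $\omega^*$ iff their common side is closed in $\omega$. Identifying the plaquette centered at $(x+1/2,y+1/2)$ with the vertex $(x,y)$ identifies the dual lattice with $\mathbb{Z}^2$, and $\mu^*$ denotes the law of $\omega^*$ when $\omega$ has law $\mu$. For an edge percolation measure $\nu$, let $\nu_{\mathrm{hp}}$ denote its marginal on the edges of $\mathbb{Z}^2$ with both endpoints in the upper half-plane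 $\mathbb{Z}\times\mathbb{Z}_{\ge 0}$, regarded as a percolation measure on that half-plane graph; write $\mu^*_{\mathrm{hp}}=(\mu^*)_{\mathrm{hp}}$. **Proposition.** Let $\mu$ be a translation-invariant edge percolation measure on $\mathbb{Z}^2$ such that $\mu_{\mathrm{hp}}$ almost surely has a unique infinite cluster (that is, exactly one). Then almost surely $\mu^*_{\mathrm{hp}}$ has no infinite cluster. -/

import Mathlib

open MeasureTheory

namespace Percolation

/-- The square lattice: the Cayley graph of `ℤ²` with generators `(1,0)` and `(0,1)`. -/
def squareLattice : SimpleGraph (ℤ × ℤ) :=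
  SimpleGraph.addCayley {((1 : ℤ), (0 : ℤ)), ((0 : ℤ), (1 : ℤ))}

theorem squareLattice_adj (u v : ℤ × ℤ) :
    squareLattice.Adj u v ↔
      (v.1 = u.1 + 1 ∧ v.2 = u.2) ∨ (v.1 = u.1 ∧ v.2 = u.2 + 1) ∨
      (u.1 = v.1 + 1 ∧ u.2 = v.2) ∨ (u.1 = v.1 ∧ u.2 = v.2 + 1) := by
  obtain ⟨a, b⟩ := u
  obtain ⟨c, d⟩ := v
  simp only [squareLattice, SimpleGraph.addCayley_adj, Set.mem_insert_iff, Set.mem_singleton_iff,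
    Prod.mk_add_mk, Prod.neg_mk, Prod.mk.injEq, ne_eq]
  omega

/-- The upper half-plane `ℤ × ℤ_{≥ 0}`, as an induced subgraph of the square lattice. -/
def halfPlane : SimpleGraph {p : ℤ × ℤ // 0 ≤ p.2} :=
  squareLattice.comap Subtype.val

/-- A percolation configuration on the edges of a graph `G`: an edge is open if its value is `true`
and closed if it is `false`.  This type carries the product `σ`-algebra. -/
abbrev Config {V : Type} (G : SimpleGraph V) : Type := G.edgeSet → Bool

/-- The subgraph, on all vertices of `G`, formed by the open edges. -/
def openGraph {V : Type} {G : SimpleGraph V} (ω : Config G) : SimpleGraph V :=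
  SimpleGraph.fromEdgeSet {e | ∃ h : e ∈ G.edgeSet, ω ⟨e, h⟩ = true}

/-- The clusters of `ω`, i.e. the connected components of the subgraph of open edges. -/
abbrev Cluster {V : Type} {G : SimpleGraph V} (ω : Config G) : Type :=
  (openGraph ω).ConnectedComponent

/-- There is exactly one infinite cluster. -/
def HasUniqueInfiniteCluster {V : Type} {G : SimpleGraph V} (ω : Config G) : Prop :=
  ∃! C : Cluster ω, C.supp.Infinite

/-- There is no infinite cluster. -/
def HasNoInfiniteCluster {V : Type} {G : SimpleGraph V} (ω : Config G) : Prop :=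
  ¬ ∃ C : Cluster ω, C.supp.Infinite

/-- Translation by `v`, as an automorphism of the square lattice. -/
def translation (v : ℤ × ℤ) : squareLattice ≃g squareLattice where
  toEquiv := Equiv.addLeft v
  map_rel_iff' := by
    intro a b
    simp only [squareLattice_adj, Equiv.coe_addLeft, Prod.fst_add, Prod.snd_add]
    omega

/-- The translation action of `ℤ²` on configurations: `e` is open in the translate of `ω` by `v`
exactly if the edge `e - v` is open in `ω`. -/
def translate (v : ℤ × ℤ) (ω : Config squareLattice) : Config squareLattice :=
  fun e => ω ((translation v).mapEdgeSet.symm e)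

/-- Invariance of an edge percolation measure under all translations by vectors of `ℤ²`. -/
def TranslationInvariant (μ : Measure (Config squareLattice)) : Prop :=
  ∀ v : ℤ × ℤ, μ.map (translate v) = μ

/-- Restriction of a configuration to the edges with both endpoints in the upper half-plane. -/
def restrictHalfPlane (ω : Config squareLattice) : Config halfPlane :=
  fun e => ω ((SimpleGraph.Hom.comap Subtype.val squareLattice).mapEdgeSet e)

/-- The marginal of an edge percolation measure on the upper half-plane. -/
noncomputable def halfPlaneMarginal (μ : Measure (Config squareLattice)) :
    Measure (Config halfPlane) :=
  μ.map restrictHalfPlane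

/-- The four corners of the plaquette (face) of the square lattice centred at
`(x + 1/2, y + 1/2)`.  This plaquette is labelled by its lower left corner `(x, y)`. -/
def corners (p : ℤ × ℤ) : Set (ℤ × ℤ) :=
  {(p.1, p.2), (p.1 + 1, p.2), (p.1, p.2 + 1), (p.1 + 1, p.2 + 1)}

/-- For adjacent plaquettes `p` and `q`, the pair of endpoints of the side which they share; here
`⊔` and `⊓` are the coordinatewise maximum and minimum (see `mem_crossedPair_iff`). -/
def crossedPair : Sym2 (ℤ × ℤ) → Sym2 (ℤ × ℤ) :=
  Sym2.lift ⟨fun p q => s(p ⊔ q, p ⊓ q + (1, 1)), fun p q => by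
    simp only [sup_comm p q, inf_comm p q]⟩

/-- The vertices in `crossedPair s(p, q)` are the common corners of the plaquettes `p` and `q`. -/
theorem mem_crossedPair_iff {p q : ℤ × ℤ} (h : squareLattice.Adj p q) (v : ℤ × ℤ) :
    v ∈ crossedPair s(p, q) ↔ v ∈ corners p ∧ v ∈ corners q := by
  rw [squareLattice_adj] at h
  obtain ⟨a, b⟩ := p
  obtain ⟨c, d⟩ := q
  obtain ⟨x, y⟩ := v
  simp only [crossedPair, corners, Sym2.lift_mk, Sym2.mem_iff, Prod.mk_sup_mk, Prod.mk_inf_mk,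
    Prod.mk_add_mk, Prod.mk.injEq, Set.mem_insert_iff, Set.mem_singleton_iff] at h ⊢
  omega

theorem crossedPair_mem_edgeSet (e : Sym2 (ℤ × ℤ)) (he : e ∈ squareLattice.edgeSet) :
    crossedPair e ∈ squareLattice.edgeSet := by
  induction e using Sym2.ind with
  | _ p q =>
    obtain ⟨a, b⟩ := p
    obtain ⟨c, d⟩ := q
    simp only [crossedPair, Sym2.lift_mk, SimpleGraph.mem_edgeSet, squareLattice_adj,
      Prod.mk_sup_mk, Prod.mk_inf_mk, Prod.mk_add_mk] at he ⊢
    omega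

/-- The planar dual of the square lattice, with plaquettes labelled by their lower left corners, is
again the square lattice.  This maps an edge of the dual to the edge of the primal lattice which
it crosses. -/
def crossedEdge (e : squareLattice.edgeSet) : squareLattice.edgeSet :=
  ⟨crossedPair e.1, crossedPair_mem_edgeSet e.1 e.2⟩

/-- The dual configuration: a dual edge is open exactly if the primal edge it crosses is closed. -/
def dualConfig (ω : Config squareLattice) : Config squareLattice :=
  fun e => ! ω (crossedEdge e)

/-- The dual measure `μ*`: the law of the dual configuration, on the plaquettes of the lattice. -/
noncomputable def dualMeasure (μ : Measure (Config squareLattice)) :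
    Measure (Config squareLattice) :=
  μ.map dualConfig

theorem measurable_translate (v : ℤ × ℤ) : Measurable (translate v) :=
  measurable_pi_lambda _ fun _ => measurable_pi_apply _

theorem measurable_restrictHalfPlane : Measurable restrictHalfPlane :=
  measurable_pi_lambda _ fun _ => measurable_pi_apply _

theorem measurable_dualConfig : Measurable dualConfig :=
  measurable_pi_lambda _ fun _ => (measurable_from_top (f := not)).comp (measurable_pi_apply _)

end Percolation

/-! Let `ω` have law `μ`. By translation invariance, almost surely every half-plane at height `n` has
exactly one infinite cluster. By stationarity, an event which almost surely persists under a family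
of translations, and is almost surely reached by one of them, has full measure. Vertical
translations thus make the infinite cluster at height `n` touch its bottom line, which gives an open
vertical edge from height `n` into the infinite cluster at height `n + 1`; horizontal translations
then give such edges arbitrarily far to the left and to the right.

If the dual had an infinite cluster in a half-plane, it would have a lowest plaquette, at height `m`
say. Two of these edges at height `m`, on either side of the plaquette, are joined by an open path
above height `m`. The resulting arc has nonzero signed crossing number with the vertical ray going
up from the plaquette. The crossing number does not change along open dual edges above the feet of
the arc, and it is nonzero for finitely many plaquettes only, so the dual cluster is finite.
-/

namespace Percolation

section Components

variable {V W : Type*} {G H : SimpleGraph V} {u v : V}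

/-- The vertex `v` percolates: its connected component in `G` is infinite. -/
def InInfiniteComponent (G : SimpleGraph V) (v : V) : Prop :=
  {w | G.Reachable v w}.Infinite

/-- The analogue of `HasUniqueInfiniteCluster` for an arbitrary graph, used to compare half-planes
at different heights. -/
def HasUniqueInfiniteComponent (G : SimpleGraph V) : Prop :=
  ∃! C : G.ConnectedComponent, C.supp.Infinite

theorem InInfiniteComponent.of_reachable (hu : InInfiniteComponent G u) (h : G.Reachable u v) :
    InInfiniteComponent G v :=
  Set.Infinite.mono (fun _ hw => h.symm.trans hw) hu

theorem InInfiniteComponent.mono (hGH : G ≤ H) (hv : InInfiniteComponent G v) :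
    InInfiniteComponent H v :=
  Set.Infinite.mono (fun _ hw => SimpleGraph.Reachable.mono hGH hw) hv

theorem InInfiniteComponent.mem_support (hv : InInfiniteComponent G v) : v ∈ G.support := by
  obtain ⟨w, hvw, hw⟩ := hv.exists_notMem_finset {v}
  exact SimpleGraph.mem_support_of_reachable (fun h => hw (by simp [h])) hvw

theorem infinite_supp_connectedComponentMk_iff :
    (G.connectedComponentMk v).supp.Infinite ↔ InInfiniteComponent G v := by
  have h : (G.connectedComponentMk v).supp = {w | G.Reachable v w} := by
    ext w
    rw [SimpleGraph.ConnectedComponent.mem_supp_iff, SimpleGraph.ConnectedComponent.eq,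
      SimpleGraph.reachable_comm]
    rfl
  rw [h, InInfiniteComponent]

theorem exists_infinite_component_iff :
    (∃ C : G.ConnectedComponent, C.supp.Infinite) ↔ ∃ v, InInfiniteComponent G v := by
  simp only [SimpleGraph.ConnectedComponent.exists, infinite_supp_connectedComponentMk_iff]

theorem hasUniqueInfiniteComponent_iff :
    HasUniqueInfiniteComponent G ↔ (∃ v, InInfiniteComponent G v) ∧
      ∀ v w, InInfiniteComponent G v → InInfiniteComponent G w → G.Reachable v w := by
  rw [← exists_infinite_component_iff]
  refine ⟨fun h => ⟨h.exists, fun v w hv hw => SimpleGraph.ConnectedComponent.exact ?_⟩,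
    fun ⟨hex, huniq⟩ => existsUnique_of_exists_of_unique hex ?_⟩
  · exact h.unique (infinite_supp_connectedComponentMk_iff.2 hv)
      (infinite_supp_connectedComponentMk_iff.2 hw)
  · exact SimpleGraph.ConnectedComponent.ind₂ fun v w hv hw =>
      SimpleGraph.ConnectedComponent.sound <| huniq v w
        (infinite_supp_connectedComponentMk_iff.1 hv) (infinite_supp_connectedComponentMk_iff.1 hw)

theorem reachable_comap_iff {f : W ↪ V} (hf : G.support ⊆ Set.range f) (a b : W) :
    (G.comap f).Reachable a b ↔ G.Reachable (f a) (f b) := by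
  refine ⟨fun h => h.map (SimpleGraph.Hom.comap f G), fun ⟨p⟩ => ?_⟩
  by_contra hab
  obtain ⟨d, -, ⟨c, hac, hc⟩, hd⟩ :=
    p.exists_boundary_dart (f '' {c | (G.comap f).Reachable a c}) ⟨a, .rfl, rfl⟩
      (by rwa [f.injective.mem_set_image])
  obtain ⟨c', hc'⟩ := hf ⟨_, d.adj.symm⟩
  have hcc' : (G.comap f).Adj c c' := by rw [SimpleGraph.comap_adj, hc, hc']; exact d.adj
  exact hd ⟨c', hac.trans hcc'.reachable, hc'⟩

theorem inInfiniteComponent_comap_iff {f : W ↪ V} (hf : G.support ⊆ Set.range f) (a : W) :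
    InInfiniteComponent (G.comap f) a ↔ InInfiniteComponent G (f a) := by
  have h : {w | G.Reachable (f a) w} ⊆ Set.range f := fun w hw => by
    by_cases haw : f a = w
    · exact ⟨a, haw⟩
    · exact hf (SimpleGraph.mem_support_of_reachable (Ne.symm haw) hw.symm)
  have h' : {b | (G.comap f).Reachable a b} = f ⁻¹' {w | G.Reachable (f a) w} :=
    Set.ext (reachable_comap_iff hf a)
  rw [InInfiniteComponent, InInfiniteComponent, h',
    ← Set.infinite_image_iff f.injective.injOn, Set.image_preimage_eq_of_subset h]

theorem hasUniqueInfiniteComponent_comap_iff {f : W ↪ V} (hf : G.support ⊆ Set.range f) :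
    HasUniqueInfiniteComponent (G.comap f) ↔ HasUniqueInfiniteComponent G := by
  simp only [hasUniqueInfiniteComponent_iff, inInfiniteComponent_comap_iff hf,
    reachable_comap_iff hf]
  constructor
  · rintro ⟨⟨a, ha⟩, h⟩
    refine ⟨⟨f a, ha⟩, fun v w hv hw => ?_⟩
    obtain ⟨b, rfl⟩ := hf hv.mem_support
    obtain ⟨c, rfl⟩ := hf hw.mem_support
    exact h b c hv hw
  · rintro ⟨⟨v, hv⟩, h⟩
    obtain ⟨a, rfl⟩ := hf hv.mem_support
    exact ⟨⟨a, hv⟩, fun b c => h (f b) (f c)⟩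

end Components

section Measurability

variable {Ω V : Type*} [MeasurableSpace Ω] {Γ : Ω → SimpleGraph V}

theorem measurableSet_isChain (hΓ : ∀ u v, MeasurableSet {ω | (Γ ω).Adj u v})
    (l : List V) : MeasurableSet {ω | l.IsChain (Γ ω).Adj} := by
  induction l with
  | nil => simp
  | cons u l ih =>
    cases l with
    | nil => simp
    | cons v l =>
      simp only [List.isChain_cons_cons]
      exact (hΓ u v).inter ih

variable [Countable V]

theorem measurableSet_infinite {S : Ω → Set V} (hS : ∀ v, MeasurableSet {ω | v ∈ S ω}) :
    MeasurableSet {ω | (S ω).Infinite} := by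
  have h : ∀ ω, (S ω).Infinite ↔ ∀ F : Finset V, ∃ v, v ∈ S ω ∧ v ∉ F := fun ω =>
    ⟨Set.Infinite.exists_notMem_finset, fun h hfin => by
      obtain ⟨v, hv, hvF⟩ := h hfin.toFinset
      exact hvF (hfin.mem_toFinset.2 hv)⟩
  simp only [h]
  exact measurableSet_setOfPred.2 <| Measurable.forall fun F => Measurable.exists fun v =>
    (measurableSet_setOfPred.1 (hS v)).and measurable_const

theorem measurableSet_reachable (hΓ : ∀ u v, MeasurableSet {ω | (Γ ω).Adj u v}) (u v : V) :
    MeasurableSet {ω | (Γ ω).Reachable u v} := by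
  have h : ∀ ω, (Γ ω).Reachable u v ↔
      ∃ l : List V, (u :: l).IsChain (Γ ω).Adj ∧ (u :: l).getLast (List.cons_ne_nil _ _) = v := by
    intro ω
    rw [SimpleGraph.reachable_iff_reflTransGen]
    exact ⟨List.exists_isChain_cons_of_relationReflTransGen,
      fun ⟨l, hl, hv⟩ => List.relationReflTransGen_of_exists_isChain_cons l hl hv⟩
  simp only [h]
  exact measurableSet_setOfPred.2 <| Measurable.exists fun l =>
    (measurableSet_setOfPred.1 (measurableSet_isChain hΓ _)).and measurable_const

theorem measurableSet_inInfiniteComponent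
    (hΓ : ∀ u v, MeasurableSet {ω | (Γ ω).Adj u v}) (v : V) :
    MeasurableSet {ω | InInfiniteComponent (Γ ω) v} :=
  measurableSet_infinite (measurableSet_reachable hΓ v)

end Measurability

section Heights

variable {G : SimpleGraph (ℤ × ℤ)} {n : ℤ} {v : ℤ × ℤ}

/-- The subgraph of `G` in the half-plane at height `n`, kept on the vertex set `ℤ × ℤ` (vertices
below height `n` become isolated) so that different heights can be compared. -/
def above (G : SimpleGraph (ℤ × ℤ)) (n : ℤ) : SimpleGraph (ℤ × ℤ) :=
  (G.induce {v | n ≤ v.2}).spanningCoe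

theorem above_adj {u v : ℤ × ℤ} : (above G n).Adj u v ↔ G.Adj u v ∧ n ≤ u.2 ∧ n ≤ v.2 := by
  simp only [above, SimpleGraph.map_adj, SimpleGraph.comap_adj,
    Function.Embedding.subtype_apply, Subtype.exists, Set.mem_ofPred_eq]
  constructor
  · rintro ⟨a, ha, b, hb, hab, rfl, rfl⟩
    exact ⟨hab, ha, hb⟩
  · rintro ⟨huv, hu, hv⟩
    exact ⟨u, hu, v, hv, huv, rfl, rfl⟩

theorem above_le : above G n ≤ G :=
  G.spanningCoe_induce_le _

theorem above_mono {H : SimpleGraph (ℤ × ℤ)} (hGH : G ≤ H) : above G n ≤ above H n :=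
  fun u v h => by
    rw [above_adj] at h ⊢
    exact ⟨hGH h.1, h.2⟩

theorem above_antitone (G : SimpleGraph (ℤ × ℤ)) : Antitone (above G) := fun m n hmn u v h => by
  rw [above_adj] at h ⊢
  exact ⟨h.1, hmn.trans h.2.1, hmn.trans h.2.2⟩

theorem le_of_mem_support_above (hv : v ∈ (above G n).support) : n ≤ v.2 := by
  obtain ⟨w, hvw⟩ := hv
  exact (above_adj.1 hvw).2.1

theorem InInfiniteComponent.le_snd (hv : InInfiniteComponent (above G n) v) : n ≤ v.2 :=
  le_of_mem_support_above hv.mem_support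

theorem reachable_above_of_forall_le {u : ℤ × ℤ}
    (hn : ∀ w, G.Reachable u w → n ≤ w.2) (huv : G.Reachable u v) :
    (above G n).Reachable u v := by
  obtain ⟨p⟩ := huv
  by_contra hv
  obtain ⟨d, -, hfst, hsnd⟩ :=
    p.exists_boundary_dart {w | (above G n).Reachable u w} .rfl hv
  have hu : G.Reachable u d.fst := SimpleGraph.Reachable.mono above_le hfst
  have hd : (above G n).Adj d.fst d.snd :=
    above_adj.2 ⟨d.adj, hn _ hu, hn _ (hu.trans d.adj.reachable)⟩
  exact hsnd (hfst.trans hd.reachable)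

theorem InInfiniteComponent.exists_lowest (hv : InInfiniteComponent (above G n) v) :
    ∃ w : ℤ × ℤ, n ≤ w.2 ∧ InInfiniteComponent (above G w.2) w := by
  have hle : ∀ w, (above G n).Reachable v w → n ≤ w.2 := fun w hw => (hv.of_reachable hw).le_snd
  obtain ⟨_, ⟨w, hvw, rfl⟩, hmin⟩ : ∃ m : ℤ, (∃ w, (above G n).Reachable v w ∧ w.2 = m) ∧
      ∀ k, (∃ w, (above G n).Reachable v w ∧ w.2 = k) → m ≤ k :=
    Int.exists_least_of_bdd ⟨n, fun k ⟨w, hw, hk⟩ => hk ▸ hle w hw⟩ ⟨v.2, v, .rfl, rfl⟩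
  refine ⟨w, hle w hvw, Set.Infinite.mono (fun x hwx => ?_) (hv.of_reachable hvw)⟩
  exact SimpleGraph.Reachable.mono (above_mono above_le) <|
    reachable_above_of_forall_le (fun z hwz => hmin _ ⟨z, hvw.trans hwz, rfl⟩) hwx

/-- The vertical edge of `G` from `(x, n)` up to `(x, n + 1)` is present and leads into an infinite
component of the half-plane at height `n + 1`. -/
def IsLeg (G : SimpleGraph (ℤ × ℤ)) (n x : ℤ) : Prop :=
  G.Adj (x, n) (x, n + 1) ∧ InInfiniteComponent (above G (n + 1)) (x, n + 1)

theorem exists_isLeg (hG : G ≤ squareLattice) (hn : HasUniqueInfiniteComponent (above G n))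
    (hn' : HasUniqueInfiniteComponent (above G (n + 1))) {x : ℤ}
    (hx : InInfiniteComponent (above G n) (x, n)) : ∃ y, IsLeg G n y := by
  obtain ⟨v, hv⟩ := (hasUniqueInfiniteComponent_iff.1 hn').1
  obtain ⟨p⟩ : (above G n).Reachable v (x, n) :=
    (hasUniqueInfiniteComponent_iff.1 hn).2 _ _ (hv.mono (above_antitone G (by omega))) hx
  -- A leg is where `p` leaves the component of `v` in the half-plane at height `n + 1`.
  obtain ⟨⟨⟨⟨a, a'⟩, ⟨b, b'⟩⟩, hab⟩, -, ha, hb⟩ :=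
    p.exists_boundary_dart {w | (above G (n + 1)).Reachable v w} .rfl
      fun h => by simpa using (hv.of_reachable h).le_snd
  have ha_inf := hv.of_reachable ha
  have hab' : n + 1 ≤ a' := ha_inf.le_snd
  obtain ⟨hadj, -, hnb⟩ := above_adj.1 hab
  have hbn : b' < n + 1 := by
    by_contra! h
    exact hb (ha.trans (above_adj.2 ⟨hadj, hab', h⟩ : (above G (n + 1)).Adj _ _).reachable)
  have hlattice := (squareLattice_adj _ _).1 (hG hadj)
  obtain ⟨rfl, rfl, rfl⟩ : b = a ∧ b' = n ∧ a' = n + 1 := by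
    dsimp only at *
    omega
  exact ⟨b, hadj.symm, ha_inf⟩

end Heights

theorem sum_darts_sub {V A : Type*} [AddCommGroup A] {G : SimpleGraph V} (f : V → A) {u v : V}
    (w : G.Walk u v) :
    (w.darts.map fun d => f d.snd - f d.fst).sum = f v - f u := by
  induction w with
  | nil => simp
  | cons h w ih => simp [ih]

section Dual

variable {G : SimpleGraph (ℤ × ℤ)} {u v : ℤ × ℤ}

/-- The signed crossing of the step from `a` to `b` with the vertical ray going up from the centre
of the plaquette `p`: it is `1` if the step crosses this ray to the right, and `-1` if it crosses
it to the left. -/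
def crossing (p a b : ℤ × ℤ) : ℤ :=
  if p.2 < a.2 then (if p.1 < b.1 then 1 else 0) - (if p.1 < a.1 then 1 else 0) else 0

/-- The number of signed crossings of a walk with the vertical ray going up from the centre of the
plaquette `p`. -/
def crossingNumber (p : ℤ × ℤ) (w : G.Walk u v) : ℤ :=
  (w.darts.map fun d => crossing p d.fst d.snd).sum

theorem crossingNumber_congr {p q : ℤ × ℤ} (h : ∀ a b, G.Adj a b → crossing p a b = crossing q a b)
    (w : G.Walk u v) : crossingNumber p w = crossingNumber q w :=
  congrArg List.sum <| List.map_congr_left fun d _ => h _ _ d.adj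

theorem crossingNumber_eq_add {p q : ℤ × ℤ} {f : ℤ × ℤ → ℤ}
    (h : ∀ a b, G.Adj a b → crossing p a b = crossing q a b + (f b - f a)) (w : G.Walk u v) :
    crossingNumber p w = crossingNumber q w + (f v - f u) := by
  rw [← sum_darts_sub f w, crossingNumber, crossingNumber, ← List.sum_map_add]
  exact congrArg List.sum <| List.map_congr_left fun d _ => h _ _ d.adj

theorem crossingNumber_eq_up (hG : G ≤ squareLattice) {i j : ℤ}
    (hij : ¬ G.Adj (i, j + 1) (i + 1, j + 1)) (w : G.Walk u v) :
    crossingNumber (i, j) w = crossingNumber (i, j + 1) w := by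
  refine crossingNumber_congr ?_ w
  rintro ⟨a, a'⟩ ⟨b, b'⟩ hab
  have hlattice := (squareLattice_adj _ _).1 (hG hab)
  have hright : ¬ (a = i ∧ a' = j + 1 ∧ b = i + 1 ∧ b' = j + 1) := by
    rintro ⟨rfl, rfl, rfl, rfl⟩
    exact hij hab
  have hleft : ¬ (b = i ∧ b' = j + 1 ∧ a = i + 1 ∧ a' = j + 1) := by
    rintro ⟨rfl, rfl, rfl, rfl⟩
    exact hij hab.symm
  simp only [crossing] at *
  split_ifs <;> omega

theorem crossingNumber_eq_right (hG : G ≤ squareLattice) {i j : ℤ}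
    (hij : ¬ G.Adj (i + 1, j) (i + 1, j + 1)) (hu : u.2 ≤ j) (hv : v.2 ≤ j) (w : G.Walk u v) :
    crossingNumber (i, j) w = crossingNumber (i + 1, j) w := by
  -- `f` is the indicator of the vertices between the two rays: besides crossing a ray, the only way
  -- to enter or leave this column is through the missing edge at its bottom.
  let f : ℤ × ℤ → ℤ := fun z => if z.1 = i + 1 ∧ j < z.2 then 1 else 0
  have hf : ∀ z : ℤ × ℤ, z.2 ≤ j → f z = 0 := fun z hz => if_neg fun h => hz.not_gt h.2
  rw [crossingNumber_eq_add (q := (i + 1, j)) (f := f), hf u hu, hf v hv, sub_zero, add_zero]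
  rintro ⟨a, a'⟩ ⟨b, b'⟩ hab
  have hlattice := (squareLattice_adj _ _).1 (hG hab)
  have hup : ¬ (a = i + 1 ∧ a' = j ∧ b = i + 1 ∧ b' = j + 1) := by
    rintro ⟨rfl, rfl, rfl, rfl⟩
    exact hij hab
  have hdown : ¬ (b = i + 1 ∧ b' = j ∧ a = i + 1 ∧ a' = j + 1) := by
    rintro ⟨rfl, rfl, rfl, rfl⟩
    exact hij hab.symm
  simp only [crossing, f] at *
  split_ifs <;> omega

theorem finite_crossingNumber_ne_zero (hG : G ≤ squareLattice) (w : G.Walk u v) (m : ℤ) :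
    {p : ℤ × ℤ | m ≤ p.2 ∧ crossingNumber p w ≠ 0}.Finite := by
  have hfin : (⋃ d ∈ {d | d ∈ w.darts},
      Set.Icc (d.fst.1 - 1) d.fst.1 ×ˢ Set.Icc m d.fst.2).Finite :=
    w.darts.finite_toSet.biUnion fun d _ => (Set.finite_Icc _ _).prod (Set.finite_Icc _ _)
  refine hfin.subset ?_
  rintro ⟨i, j⟩ ⟨hj, hne⟩
  obtain ⟨d, hd, hcross⟩ : ∃ d ∈ w.darts, crossing (i, j) d.fst d.snd ≠ 0 := by
    by_contra! h
    exact hne (List.sum_eq_zero (by simpa using h))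
  refine Set.mem_biUnion hd ?_
  have hlattice := (squareLattice_adj _ _).1 (hG d.adj)
  simp only [crossing, Set.mem_prod, Set.mem_Icc] at *
  split_ifs at hcross <;> omega

/-- The dual of a subgraph `G` of the square lattice, with plaquettes labelled by their lower left
corners: adjacent plaquettes are joined if their common side is not in `G`. -/
def dualGraph (G : SimpleGraph (ℤ × ℤ)) : SimpleGraph (ℤ × ℤ) where
  Adj p q := squareLattice.Adj p q ∧ crossedPair s(p, q) ∉ G.edgeSet
  symm := ⟨fun _ _ h => ⟨h.1.symm, Sym2.eq_swap ▸ h.2⟩⟩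
  loopless := ⟨fun _ h => squareLattice.irrefl h.1⟩

theorem crossingNumber_eq_of_dualGraph_adj (hG : G ≤ squareLattice) {p q : ℤ × ℤ}
    (hpq : (dualGraph G).Adj p q) (hu : u.2 ≤ p.2) (hv : v.2 ≤ p.2) (w : G.Walk u v) :
    crossingNumber p w = crossingNumber q w := by
  obtain ⟨hlattice, hcrossed⟩ := hpq
  obtain ⟨i, j⟩ := p
  obtain ⟨i', j'⟩ := q
  have hcases := (squareLattice_adj _ _).1 hlattice
  dsimp only at hcases
  rcases hcases with ⟨rfl, rfl⟩ | ⟨rfl, rfl⟩ | ⟨rfl, rfl⟩ | ⟨rfl, rfl⟩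
  · exact crossingNumber_eq_right hG (by simpa [crossedPair] using hcrossed) hu hv w
  · exact crossingNumber_eq_up hG (by simpa [crossedPair] using hcrossed) w
  · exact (crossingNumber_eq_right hG (by simpa [crossedPair] using hcrossed) hu hv w).symm
  · exact (crossingNumber_eq_up hG (by simpa [crossedPair] using hcrossed) w).symm

theorem crossingNumber_eq_of_reachable (hG : G ≤ squareLattice) {m : ℤ} {p q : ℤ × ℤ}
    (hpq : (above (dualGraph G) m).Reachable p q) (hu : u.2 ≤ m) (hv : v.2 ≤ m) (w : G.Walk u v) :
    crossingNumber p w = crossingNumber q w := by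
  obtain ⟨γ⟩ := hpq
  induction γ with
  | nil => rfl
  | cons h _ ih =>
    obtain ⟨hadj, hm, -⟩ := above_adj.1 h
    exact (crossingNumber_eq_of_dualGraph_adj hG hadj (hu.trans hm) (hv.trans hm) w).trans ih

theorem not_inInfiniteComponent_of_crossingNumber_ne_zero (hG : G ≤ squareLattice) {p : ℤ × ℤ}
    (hu : u.2 ≤ p.2) (hv : v.2 ≤ p.2) {w : G.Walk u v} (hw : crossingNumber p w ≠ 0) :
    ¬ InInfiniteComponent (above (dualGraph G) p.2) p := fun hp =>
  hp <| (finite_crossingNumber_ne_zero hG w p.2).subset fun _ hq =>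
    ⟨(hp.of_reachable hq).le_snd, crossingNumber_eq_of_reachable hG hq hu hv w ▸ hw⟩

theorem crossingNumber_of_forall_lt {p : ℤ × ℤ} {w : G.Walk u v}
    (hw : ∀ d ∈ w.darts, p.2 < d.fst.2) :
    crossingNumber p w = (if p.1 < v.1 then 1 else 0) - (if p.1 < u.1 then 1 else 0) := by
  rw [← sum_darts_sub (fun z : ℤ × ℤ => if p.1 < z.1 then (1 : ℤ) else 0) w]
  exact congrArg List.sum <| List.map_congr_left fun d hd => if_pos (hw d hd)

theorem exists_walk_crossingNumber_ne_zero {i m x y : ℤ}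
    (hm : HasUniqueInfiniteComponent (above G (m + 1))) (hx : IsLeg G m x) (hy : IsLeg G m y)
    (hxi : x ≤ i) (hiy : i < y) :
    ∃ w : G.Walk (x, m) (y, m), crossingNumber (i, m) w ≠ 0 := by
  obtain ⟨w⟩ := (hasUniqueInfiniteComponent_iff.1 hm).2 _ _ hx.2 hy.2
  let w' : G.Walk (x, m + 1) (y, m + 1) := w.mapLe above_le
  have hw' : crossingNumber (i, m) w' = 1 := by
    rw [crossingNumber_of_forall_lt]
    · simp [hxi.not_gt, hiy]
    · simp only [w', SimpleGraph.Walk.darts_map, List.mem_map]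
      rintro _ ⟨d, -, rfl⟩
      exact (above_adj.1 d.adj).2.1
  refine ⟨.cons hx.1 (w'.concat hy.1.symm), ?_⟩
  have hsum : crossingNumber (i, m) (.cons hx.1 (w'.concat hy.1.symm)) =
      crossing (i, m) (x, m) (x, m + 1) + (crossingNumber (i, m) w' +
        crossing (i, m) (y, m + 1) (y, m)) := by
    simp [crossingNumber]
  rw [hsum, hw']
  simp [crossing]

theorem not_inInfiniteComponent_above_dualGraph (hG : G ≤ squareLattice)
    (hunique : ∀ m, HasUniqueInfiniteComponent (above G m))
    (hleft : ∀ m k, ∃ x ≤ k, IsLeg G m x) (hright : ∀ m k, ∃ x > k, IsLeg G m x)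
    (n : ℤ) (p : ℤ × ℤ) : ¬ InInfiniteComponent (above (dualGraph G) n) p := by
  intro hp
  obtain ⟨⟨i, m⟩, -, hlowest⟩ := hp.exists_lowest
  obtain ⟨x, hxi, hx⟩ := hleft m i
  obtain ⟨y, hiy, hy⟩ := hright m i
  obtain ⟨w, hw⟩ := exists_walk_crossingNumber_ne_zero (hunique (m + 1)) hx hy hxi hiy
  exact not_inInfiniteComponent_of_crossingNumber_ne_zero (p := (i, m)) (w := w) hG
    (le_refl m) (le_refl m) hw hlowest

end Dual

section Configurations

theorem openGraph_adj {V : Type} {G : SimpleGraph V} (ω : Config G) (u v : V) :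
    (openGraph ω).Adj u v ↔ ∃ h : G.Adj u v, ω ⟨s(u, v), h⟩ = true := by
  rw [openGraph, SimpleGraph.fromEdgeSet_adj]
  exact ⟨fun h => h.1, fun h => ⟨h, h.1.ne⟩⟩

theorem openGraph_le {V : Type} {G : SimpleGraph V} (ω : Config G) : openGraph ω ≤ G :=
  fun u v h => ((openGraph_adj ω u v).1 h).1

theorem measurableSet_openGraph_adj {V : Type} (G : SimpleGraph V) (u v : V) :
    MeasurableSet {ω : Config G | (openGraph ω).Adj u v} := by
  simp only [openGraph_adj]
  exact measurableSet_setOfPred.2 <| Measurable.exists fun _ =>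
    measurableSet_setOfPred.1 <| measurableSet_eq_fun (measurable_pi_apply _) measurable_const

theorem measurableSet_inInfiniteComponent_above (n : ℤ) (v : ℤ × ℤ) :
    MeasurableSet {ω : Config squareLattice |
      InInfiniteComponent (above (openGraph ω) n) v} := by
  refine measurableSet_inInfiniteComponent (fun u w => ?_) v
  simp only [above_adj]
  exact (measurableSet_openGraph_adj _ u w).inter (.const _)

theorem measurableSet_isLeg (n x : ℤ) :
    MeasurableSet {ω : Config squareLattice | IsLeg (openGraph ω) n x} :=
  (measurableSet_openGraph_adj _ _ _).inter (measurableSet_inInfiniteComponent_above _ _)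

theorem measurableSet_hasNoInfiniteCluster {V : Type} [Countable V] (G : SimpleGraph V) :
    MeasurableSet {ω : Config G | HasNoInfiniteCluster ω} := by
  simp only [HasNoInfiniteCluster, exists_infinite_component_iff]
  exact measurableSet_setOfPred.2 <| .not <| .exists fun v => measurableSet_setOfPred.1 <|
    measurableSet_inInfiniteComponent (measurableSet_openGraph_adj G) v

theorem openGraph_dualConfig (ω : Config squareLattice) :
    openGraph (dualConfig ω) = dualGraph (openGraph ω) := by
  ext p q
  have hmem : ∀ e : squareLattice.edgeSet, e.1 ∈ (openGraph ω).edgeSet ↔ ω e = true := by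
    rintro ⟨⟨a, b⟩, hab⟩
    exact (openGraph_adj ω a b).trans ⟨fun h => h.2, fun h => ⟨hab, h⟩⟩
  have hdual : ∀ h : squareLattice.Adj p q, dualConfig ω ⟨s(p, q), h⟩ = true ↔
      crossedPair s(p, q) ∉ (openGraph ω).edgeSet := fun h => by
    rw [dualConfig, Bool.not_eq_true', ← Bool.not_eq_true]
    exact (hmem (crossedEdge ⟨s(p, q), h⟩)).not.symm
  exact (openGraph_adj _ p q).trans ((exists_congr hdual).trans exists_prop)

theorem openGraph_restrictHalfPlane (ω : Config squareLattice) :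
    openGraph (restrictHalfPlane ω) =
      (above (openGraph ω) 0).comap (Function.Embedding.subtype _) := by
  ext a b
  rw [SimpleGraph.comap_adj, above_adj, openGraph_adj, openGraph_adj]
  exact (and_iff_left ⟨a.2, b.2⟩).symm

theorem support_above_zero_subset (G : SimpleGraph (ℤ × ℤ)) :
    (above G 0).support ⊆ Set.range (Function.Embedding.subtype fun v : ℤ × ℤ => 0 ≤ v.2) :=
  fun v hv => ⟨⟨v, le_of_mem_support_above hv⟩, rfl⟩

theorem hasUniqueInfiniteCluster_restrictHalfPlane_iff (ω : Config squareLattice) :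
    HasUniqueInfiniteCluster (restrictHalfPlane ω) ↔
      HasUniqueInfiniteComponent (above (openGraph ω) 0) := by
  rw [← hasUniqueInfiniteComponent_comap_iff (support_above_zero_subset _),
    ← openGraph_restrictHalfPlane]
  rfl

theorem hasNoInfiniteCluster_restrictHalfPlane {ω : Config squareLattice}
    (h : ∀ v, ¬ InInfiniteComponent (above (openGraph ω) 0) v) :
    HasNoInfiniteCluster (restrictHalfPlane ω) := by
  rw [HasNoInfiniteCluster, exists_infinite_component_iff, openGraph_restrictHalfPlane]
  rintro ⟨v, hv⟩
  exact h _ ((inInfiniteComponent_comap_iff (support_above_zero_subset _) v).1 hv)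

end Configurations

section Translations

variable (ω : Config squareLattice) (v : ℤ × ℤ) (n x : ℤ)

theorem openGraph_translate :
    openGraph (translate v ω) = (openGraph ω).comap (Equiv.subRight v) := by
  ext a b
  have hsymm : ∀ a, (translation v).symm a = a - v := fun a => neg_add_eq_sub v a
  have hadj : squareLattice.Adj (a - v) (b - v) ↔ squareLattice.Adj a b := by
    simpa only [hsymm] using (translation v).symm.map_adj_iff (v := a) (w := b)
  have hvalue : ∀ hab : squareLattice.Adj a b,
      translate v ω ⟨s(a, b), hab⟩ = ω ⟨s(a - v, b - v), hadj.2 hab⟩ := fun hab =>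
    congrArg ω <| Subtype.ext <| congrArg₂ (fun c d => s(c, d)) (hsymm a) (hsymm b)
  rw [SimpleGraph.comap_adj, openGraph_adj, openGraph_adj]
  exact ⟨fun ⟨hab, h⟩ => ⟨hadj.2 hab, hvalue hab ▸ h⟩,
    fun ⟨hab, h⟩ => ⟨hadj.1 hab, (hvalue _).trans h⟩⟩

theorem above_openGraph_translate : above (openGraph (translate v ω)) n =
    (above (openGraph ω) (n - v.2)).comap (Equiv.subRight v).toEmbedding := by
  ext a b
  simp [openGraph_translate, above_adj]

theorem hasUniqueInfiniteComponent_above_translate_iff :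
    HasUniqueInfiniteComponent (above (openGraph (translate v ω)) n) ↔
      HasUniqueInfiniteComponent (above (openGraph ω) (n - v.2)) := by
  rw [above_openGraph_translate, hasUniqueInfiniteComponent_comap_iff (by simp)]

theorem inInfiniteComponent_above_translate_iff (u : ℤ × ℤ) :
    InInfiniteComponent (above (openGraph (translate v ω)) n) u ↔
      InInfiniteComponent (above (openGraph ω) (n - v.2)) (u - v) := by
  rw [above_openGraph_translate, inInfiniteComponent_comap_iff (by simp)]
  rfl

theorem isLeg_translate_iff :
    IsLeg (openGraph (translate v ω)) n x ↔ IsLeg (openGraph ω) (n - v.2) (x - v.1) := by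
  have hsub : ∀ m, (x, m) - v = (x - v.1, m - v.2) := fun m => rfl
  rw [IsLeg, IsLeg, inInfiniteComponent_above_translate_iff, openGraph_translate,
    SimpleGraph.comap_adj, Equiv.subRight_apply, Equiv.subRight_apply, hsub, hsub,
    ← sub_add_eq_add_sub]

end Translations

section Stationarity

-- Invariance gives `s` and its preimages the same finite measure, so `himp` is almost surely an
-- equivalence.
theorem ae_mem_of_ae_imp_of_ae_exists {ι Ω : Type*} [Countable ι] [MeasurableSpace Ω]
    {μ : Measure Ω} [IsFiniteMeasure μ] {T : ι → Ω → Ω} (hT : ∀ i, MeasurePreserving (T i) μ μ)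
    {s : Set Ω} (hs : NullMeasurableSet s μ) (himp : ∀ i, ∀ᵐ ω ∂μ, ω ∈ s → T i ω ∈ s)
    (hex : ∀ᵐ ω ∂μ, ∃ i, T i ω ∈ s) : ∀ᵐ ω ∂μ, ω ∈ s := by
  have heq : ∀ i, s =ᵐ[μ] T i ⁻¹' s := fun i =>
    ae_eq_of_ae_subset_of_measure_ge (himp i) ((hT i).measure_preimage hs).le hs
      (measure_ne_top _ _)
  filter_upwards [ae_all_iff.2 fun i => (heq i).mem_iff, hex] with ω hω ⟨i, hi⟩
  exact (hω i).2 hi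

variable {μ : Measure (Config squareLattice)}

theorem TranslationInvariant.measurePreserving (hμ : TranslationInvariant μ) (v : ℤ × ℤ) :
    MeasurePreserving (translate v) μ μ :=
  ⟨measurable_translate v, hμ v⟩

theorem TranslationInvariant.ae_hasUniqueInfiniteComponent (hμ : TranslationInvariant μ)
    (h : ∀ᵐ ω ∂μ, HasUniqueInfiniteComponent (above (openGraph ω) 0)) :
    ∀ᵐ ω ∂μ, ∀ n, HasUniqueInfiniteComponent (above (openGraph ω) n) := by
  refine ae_all_iff.2 fun n => ?_
  filter_upwards [(hμ.measurePreserving (0, -n)).quasiMeasurePreserving.ae h] with ω hω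
  simpa [hasUniqueInfiniteComponent_above_translate_iff] using hω

variable [IsFiniteMeasure μ]

theorem TranslationInvariant.ae_exists_inInfiniteComponent_bottom (hμ : TranslationInvariant μ)
    (h : ∀ᵐ ω ∂μ, ∀ n, HasUniqueInfiniteComponent (above (openGraph ω) n)) (n : ℤ) :
    ∀ᵐ ω ∂μ, ∃ x, InInfiniteComponent (above (openGraph ω) n) (x, n) := by
  have hshift : ∀ (k : ℕ) ω,
      (∃ x, InInfiniteComponent (above (openGraph (translate (0, -(k : ℤ)) ω)) n) (x, n)) ↔
        ∃ x, InInfiniteComponent (above (openGraph ω) (n + k)) (x, n + k) := fun k ω => by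
    simp [inInfiniteComponent_above_translate_iff]
  refine ae_mem_of_ae_imp_of_ae_exists
    (s := {ω | ∃ x, InInfiniteComponent (above (openGraph ω) n) (x, n)})
    (fun k : ℕ => hμ.measurePreserving (0, -(k : ℤ))) ?_ (fun k => ?_) ?_
  · exact (measurableSet_setOfPred.2 <| .exists fun x => measurableSet_setOfPred.1 <|
      measurableSet_inInfiniteComponent_above n (x, n)).nullMeasurableSet
  · filter_upwards [h] with ω hω hbottom
    refine (hshift k ω).2 ?_
    induction k with
    | zero => simpa using hbottom
    | succ k ih =>
      obtain ⟨x, hx⟩ := ih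
      obtain ⟨y, -, hy⟩ := exists_isLeg (openGraph_le ω) (hω _) (hω _) hx
      exact ⟨y, by simpa [add_assoc] using hy⟩
  · filter_upwards [h] with ω hω
    obtain ⟨v, hv⟩ := (hasUniqueInfiniteComponent_iff.1 (hω n)).1
    obtain ⟨⟨x, m⟩, hnm, hx⟩ := hv.exists_lowest
    obtain ⟨k, rfl⟩ := Int.le.dest hnm
    exact ⟨k, (hshift k ω).2 ⟨x, hx⟩⟩

theorem TranslationInvariant.ae_exists_isLeg (hμ : TranslationInvariant μ)
    (h : ∀ᵐ ω ∂μ, ∀ n, HasUniqueInfiniteComponent (above (openGraph ω) n)) (n : ℤ) :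
    ∀ᵐ ω ∂μ, ∃ x, IsLeg (openGraph ω) n x := by
  filter_upwards [h, hμ.ae_exists_inInfiniteComponent_bottom h n] with ω hω ⟨x, hx⟩
  exact exists_isLeg (openGraph_le ω) (hω n) (hω (n + 1)) hx

theorem TranslationInvariant.ae_exists_isLeg_mem (hμ : TranslationInvariant μ) {n : ℤ}
    (h : ∀ᵐ ω ∂μ, ∃ x, IsLeg (openGraph ω) n x) {S : Set ℤ}
    (hS : ∀ x, ∃ u, (∀ y ∈ S, y + u ∈ S) ∧ x + u ∈ S) :
    ∀ᵐ ω ∂μ, ∃ x ∈ S, IsLeg (openGraph ω) n x := by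
  have hshift : ∀ ω u x, IsLeg (openGraph (translate (u, 0) ω)) n (x + u) ↔
      IsLeg (openGraph ω) n x := fun ω u x => by simp [isLeg_translate_iff]
  refine ae_mem_of_ae_imp_of_ae_exists (s := {ω | ∃ x ∈ S, IsLeg (openGraph ω) n x})
    (fun u : {u // ∀ y ∈ S, y + u ∈ S} => hμ.measurePreserving (u, 0)) ?_ ?_ ?_
  · exact (measurableSet_setOfPred.2 <| .exists fun x => measurable_const.and <|
      measurableSet_setOfPred.1 <| measurableSet_isLeg n x).nullMeasurableSet
  · rintro ⟨u, hu⟩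
    exact .of_forall fun ω ⟨x, hx, hleg⟩ => ⟨x + u, hu x hx, (hshift ω u x).2 hleg⟩
  · filter_upwards [h] with ω ⟨x, hleg⟩
    obtain ⟨u, hu, hxu⟩ := hS x
    exact ⟨⟨u, hu⟩, x + u, hxu, (hshift ω u x).2 hleg⟩

theorem TranslationInvariant.ae_exists_isLeg_le (hμ : TranslationInvariant μ) {n : ℤ}
    (h : ∀ᵐ ω ∂μ, ∃ x, IsLeg (openGraph ω) n x) (k : ℤ) :
    ∀ᵐ ω ∂μ, ∃ x ≤ k, IsLeg (openGraph ω) n x :=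
  hμ.ae_exists_isLeg_mem h (S := Set.Iic k) fun x =>
    ⟨min 0 (k - x), fun y hy => by rw [Set.mem_Iic] at *; omega, by rw [Set.mem_Iic]; omega⟩

theorem TranslationInvariant.ae_exists_isLeg_gt (hμ : TranslationInvariant μ) {n : ℤ}
    (h : ∀ᵐ ω ∂μ, ∃ x, IsLeg (openGraph ω) n x) (k : ℤ) :
    ∀ᵐ ω ∂μ, ∃ x > k, IsLeg (openGraph ω) n x :=
  hμ.ae_exists_isLeg_mem h (S := Set.Ioi k) fun x =>
    ⟨max 0 (k + 1 - x), fun y hy => by rw [Set.mem_Ioi] at *; omega, by rw [Set.mem_Ioi]; omega⟩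

end Stationarity

theorem ae_halfPlaneMarginal_iff {μ : Measure (Config squareLattice)} {P : Config halfPlane → Prop}
    (hP : MeasurableSet {ω | P ω}) :
    (∀ᵐ ω ∂halfPlaneMarginal μ, P ω) ↔ ∀ᵐ ω ∂μ, P (restrictHalfPlane ω) :=
  ae_map_iff measurable_restrictHalfPlane.aemeasurable hP

theorem ae_dualMeasure_iff {μ : Measure (Config squareLattice)} {P : Config squareLattice → Prop}
    (hP : MeasurableSet {ω | P ω}) :
    (∀ᵐ ω ∂dualMeasure μ, P ω) ↔ ∀ᵐ ω ∂μ, P (dualConfig ω) :=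
  ae_map_iff measurable_dualConfig.aemeasurable hP

end Percolation

open Percolation

theorem proposition2p6
    (μ : MeasureTheory.Measure (Percolation.Config Percolation.squareLattice))
    [MeasureTheory.IsProbabilityMeasure μ]
    (hμ : Percolation.TranslationInvariant μ)
    (hunique : ∀ᵐ ω ∂(Percolation.halfPlaneMarginal μ), Percolation.HasUniqueInfiniteCluster ω) :
    ∀ᵐ ω ∂(Percolation.halfPlaneMarginal (Percolation.dualMeasure μ)),
      Percolation.HasNoInfiniteCluster ω := by
  have hmeas := measurableSet_hasNoInfiniteCluster halfPlane
  rw [ae_halfPlaneMarginal_iff hmeas, ae_dualMeasure_iff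
    (P := fun ω => HasNoInfiniteCluster (restrictHalfPlane ω)) (measurable_restrictHalfPlane hmeas)]
  have hunique_zero : ∀ᵐ ω ∂μ, HasUniqueInfiniteComponent (above (openGraph ω) 0) := by
    filter_upwards [ae_of_ae_map measurable_restrictHalfPlane.aemeasurable hunique] with ω hω
    exact (hasUniqueInfiniteCluster_restrictHalfPlane_iff ω).1 hω
  have hunique_all := hμ.ae_hasUniqueInfiniteComponent hunique_zero
  have hleg := hμ.ae_exists_isLeg hunique_all
  have hleft := ae_all_iff.2 fun n => ae_all_iff.2 (hμ.ae_exists_isLeg_le (hleg n))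
  have hright := ae_all_iff.2 fun n => ae_all_iff.2 (hμ.ae_exists_isLeg_gt (hleg n))
  filter_upwards [hunique_all, hleft, hright] with ω hω hωleft hωright
  refine hasNoInfiniteCluster_restrictHalfPlane fun v => ?_
  rw [openGraph_dualConfig]
  exact not_inInfiniteComponent_above_dualGraph (openGraph_le ω) hω hωleft hωright 0 v
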